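/- Conventions. Let $\mathcal C$ be a category with zero morphisms, binary coproducts and kernels. For objects $B,X$ let $\kappa\colon B\flat X\to B+X$ be the kernel of $[1,0]\colon B+X\to B$; for $f\colon A\to B$, $h\colon X\to Y$ let $f\flat h\colon A\flat X\to B\flat Y$ be the restriction of $f+h$. The functor $B\flat(-)$ is a monad, whose unit $X\to B\flat X$ and multiplication $B\flat(B\flat X)\to B\flat X$ are the restrictions of the injection $X\to B+X$ and of $[\iota_B,\kappa]\colon B+B\flat X\to B+X$, where $\iota_B\colon B\to B+X$ is the injection. An (internal) action of $B$ on $X$ is a morphism $\xi\colon B\flat X\to X$ making $X$ an algebra for this monad. Restricting $\xi$ along $f\colon A\to B$ to $\xi\circ(f\flat 1)$ makes $B\mapsto\{\text{actions of }B\text{ on }X\}$ a functor $\mathrm{Act}(-,X)\colon\mathcal C^{op}\to\mathbf{Set}$. A cospan $A\xrightarrow{f}B\xleftarrow{g}D$ is jointly strongly epimorphic if, whenever $m\colon M\to N$ is a monomorphism and $a\colon A\to M$, $d\colon D\to M$, $h\colon B\to N$ satisfy $ma=hf$ and $md=hg$, there is $t\colon B\to M$ with $tf=a$, $tg=d$,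 $mt=h$. Condition (UA): for every jointly strongly epimorphic cospan $A\xrightarrow{f}B\xleftarrow{g}D$, every object $X$ and all actions $\xi_1$ of $A$, $\xi_2$ of $D$, and $\xi_3,\xi_4$ of $B$ on $X$, if $$\xi_3\circ(f\flat 1)=\xi_1=\xi_4\circ(f\flat 1),\qquad \xi_3\circ(g\flat 1)=\xi_2=\xi_4\circ(g\flat 1),$$ then $\xi_3=\xi_4$. A category is semi-abelian if it is pointed, Barr exact, protomodular (the Split Short Five Lemma holds) and has finite coproducts. A semi-abelian category is action representative if for every object $X$ the functor $\mathrm{Act}(-,X)$ is representable. A category of interest (Orzech) is the category of all models of a theory consisting of the operations $0,-,+$, a set $\Omega_1'$ of further unary and a set $\Omega_2'$ of further binary operations, and a set of identities that includes the group laws for $0,-,+$ (where $+$ need not be commutative), such that the following hold in all models: 1. for every $*\in\Omega_2'$ there is $*^{\circ}\in\Omega_2'$ with $x*^{\circ}y=y*x$; 2. $x*(y+z)=x*y+x*z$ for $*\in\Omega_2'$; 3. $\omega(x+y)=\omega(x)+\omega(y)$ and $\omega(x)*y=\omega(x*y)$ for $\omega\in\Omega_1'$, $*\in\Omega_2'$;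 4. $x+(y*z)=(y*z)+x$ for $*\in\Omega_2'$; 5. for all $*,\bar *\in\Omega_2'$ there is a word $W$ in the operations of the theory such that $$(x_1*x_2)\,\bar *\,x_3=W\big(x_1(x_2x_3),x_1(x_3x_2),(x_2x_3)x_1,(x_3x_2)x_1,x_2(x_1x_3),x_2(x_3x_1),(x_1x_3)x_2,(x_3x_1)x_2\big),$$ where each juxtaposition stands for an operation of $\Omega_2'$ (the same form may occur in $W$ with different operations). Proposition. (i) Every action representative semi-abelian category satisfies (UA). (ii) Every category of interest satisfies (UA). -/

import Mathlib

open CategoryTheory CategoryTheory.Limits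

universe u v w

/-! ### Semi-abelian categories -/

section SemiAbelian

variable (C : Type u) [Category.{v} C] [HasZeroMorphisms C]

/-- The Split Short Five Lemma, i.e. Bourn protomodularity for pointed categories with finite
limits: in a morphism of split extensions
```
  K  --k-->  A  <==p,s==>  B
  |u         |m            |n
  K' --k'--> A' <=p',s'=>  B'
```
(`k`, `k'` kernels of the split epimorphisms `p`, `p'` with chosen sections `s`, `s'`),
if `u` and `n` are isomorphisms, then so is `m`. -/
def SplitShortFive : Prop :=
  ∀ ⦃K A B K' A' B' : C⦄ (k : K ⟶ A) (p : A ⟶ B) (s : B ⟶ A)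
    (k' : K' ⟶ A') (p' : A' ⟶ B') (s' : B' ⟶ A')
    (hk : k ≫ p = 0) (hk' : k' ≫ p' = 0),
    s ≫ p = 𝟙 B → s' ≫ p' = 𝟙 B' →
    Nonempty (IsLimit (KernelFork.ofι k hk)) → Nonempty (IsLimit (KernelFork.ofι k' hk')) →
    ∀ (u : K ⟶ K') (m : A ⟶ A') (n : B ⟶ B'),
      k ≫ m = u ≫ k' → p ≫ n = m ≫ p' → s ≫ m = n ≫ s' →
      IsIso u → IsIso n → IsIso m

/-- A semi-abelian category: pointed, with finite coproducts, Barr exact (regular, and every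
internal equivalence relation is a kernel pair) and protomodular. -/
class SemiAbelian : Prop extends HasZeroObject C, Regular C where
  finiteCoproducts : HasFiniteCoproducts C
  effective : ∀ ⦃R A : C⦄ (p₁ p₂ : R ⟶ A), IsEquivalenceRelation p₁ p₂ →
    ∃ (Q : C) (q : A ⟶ Q), IsKernelPair q p₁ p₂
  protomodular : SplitShortFive C

attribute [instance] SemiAbelian.finiteCoproducts

end SemiAbelian

/-! ### Internal actions -/

section InternalActions

variable {C : Type u} [Category.{v} C]

/-- The cospan `f : A ⟶ B`, `g : D ⟶ B` is jointly strongly epimorphic: it has the (joint) left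
lifting property with respect to all monomorphisms. -/
def JointlyStronglyEpi {A B D : C} (f : A ⟶ B) (g : D ⟶ B) : Prop :=
  ∀ ⦃M N : C⦄ (m : M ⟶ N) [Mono m] (a : A ⟶ M) (d : D ⟶ M) (h : B ⟶ N),
    a ≫ m = f ≫ h → d ≫ m = g ≫ h →
    ∃ t : B ⟶ M, f ≫ t = a ∧ g ≫ t = d ∧ t ≫ m = h

variable [HasZeroMorphisms C] [HasBinaryCoproducts C] [HasKernels C]

/-- `B ♭ X`, the kernel of `[1, 0] : B + X ⟶ B`. -/
noncomputable def flat (B X : C) : C := kernel (coprod.desc (𝟙 B) (0 : X ⟶ B))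

/-- The inclusion `κ : B ♭ X ⟶ B + X`. -/
noncomputable def flatι (B X : C) : flat B X ⟶ B ⨿ X := kernel.ι _

instance (B X : C) : Mono (flatι B X) :=
  inferInstanceAs (Mono (kernel.ι (coprod.desc (𝟙 B) (0 : X ⟶ B))))

@[simp]
theorem flatι_comp (B X : C) : flatι B X ≫ coprod.desc (𝟙 B) (0 : X ⟶ B) = 0 :=
  kernel.condition _

@[simp]
theorem flatι_comp_assoc (B X : C) {Z : C} (h : B ⟶ Z) :
    flatι B X ≫ coprod.desc (𝟙 B) (0 : X ⟶ B) ≫ h = 0 := by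
  rw [← Category.assoc, flatι_comp, zero_comp]

/-- The universal property of the kernel `B ♭ X`. -/
noncomputable def flatLift {B X Z : C} (h : Z ⟶ B ⨿ X)
    (w : h ≫ coprod.desc (𝟙 B) (0 : X ⟶ B) = 0) : Z ⟶ flat B X := kernel.lift _ h w

@[simp]
theorem flatLift_ι {B X Z : C} (h : Z ⟶ B ⨿ X)
    (w : h ≫ coprod.desc (𝟙 B) (0 : X ⟶ B) = 0) : flatLift h w ≫ flatι B X = h :=
  kernel.lift_ι _ _ _

@[simp]
theorem flatLift_ι_assoc {B X Z W : C} (h : Z ⟶ B ⨿ X)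
    (w : h ≫ coprod.desc (𝟙 B) (0 : X ⟶ B) = 0) (k : B ⨿ X ⟶ W) :
    flatLift h w ≫ flatι B X ≫ k = h ≫ k := by
  rw [← Category.assoc, flatLift_ι]

/-- `f ♭ h : A ♭ X ⟶ B ♭ Y`, the restriction of `f + h`. -/
noncomputable def flatMap {A B X Y : C} (f : A ⟶ B) (h : X ⟶ Y) : flat A X ⟶ flat B Y :=
  flatLift (flatι A X ≫ coprod.map f h) (by
    have : coprod.map f h ≫ coprod.desc (𝟙 B) (0 : Y ⟶ B)
        = coprod.desc (𝟙 A) (0 : X ⟶ A) ≫ f := by ext <;> simp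
    rw [Category.assoc, this, flatι_comp_assoc])

/-- The unit `X ⟶ B ♭ X` of the monad `B ♭ -`, the restriction of the coproduct injection. -/
noncomputable def flatUnit (B X : C) : X ⟶ flat B X :=
  flatLift coprod.inr (coprod.inr_desc _ _)

/-- The multiplication `B ♭ (B ♭ X) ⟶ B ♭ X` of the monad `B ♭ -`, the restriction of
`[inl, κ] : B + B ♭ X ⟶ B + X`. -/
noncomputable def flatMult (B X : C) : flat B (flat B X) ⟶ flat B X :=
  flatLift (flatι B (flat B X) ≫ coprod.desc coprod.inl (flatι B X)) (by
    have : coprod.desc coprod.inl (flatι B X) ≫ coprod.desc (𝟙 B) (0 : X ⟶ B)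
        = coprod.desc (𝟙 B) (0 : flat B X ⟶ B) := by
      ext
      · rw [coprod.inl_desc_assoc, coprod.inl_desc, coprod.inl_desc]
      · rw [coprod.inr_desc_assoc, flatι_comp, coprod.inr_desc]
    rw [Category.assoc, this, flatι_comp])

/-- An internal action of `B` on `X`: a structure of algebra on `X` for the monad `B ♭ -`. -/
@[ext]
structure InternalAction (B X : C) where
  /-- the structure morphism -/
  ξ : flat B X ⟶ X
  unit : flatUnit B X ≫ ξ = 𝟙 X
  assoc : flatMult B X ≫ ξ = flatMap (𝟙 B) ξ ≫ ξ

theorem flatMap_comp {A B D X Y Z : C} (f : A ⟶ B) (g : B ⟶ D) (h : X ⟶ Y) (k : Y ⟶ Z) :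
    flatMap f h ≫ flatMap g k = flatMap (f ≫ g) (h ≫ k) := by
  rw [← cancel_mono (flatι D Z)]
  simp [flatMap]

theorem flatMap_id (B X : C) : flatMap (𝟙 B) (𝟙 X) = 𝟙 (flat B X) := by
  rw [← cancel_mono (flatι B X)]
  simp [flatMap]

theorem flatUnit_flatMap {A B : C} (f : A ⟶ B) (X : C) :
    flatUnit A X ≫ flatMap f (𝟙 X) = flatUnit B X := by
  rw [← cancel_mono (flatι B X)]
  simp [flatMap, flatUnit]

theorem flatMult_flatMap {A B : C} (f : A ⟶ B) (X : C) :
    flatMult A X ≫ flatMap f (𝟙 X) = flatMap f (flatMap f (𝟙 X)) ≫ flatMult B X := by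
  rw [← cancel_mono (flatι B X)]
  simp only [flatMap, flatMult, Category.assoc, flatLift_ι, flatLift_ι_assoc]
  congr 1
  ext <;> simp

/-- The restriction of an action of `B` on `X` along `f : A ⟶ B`, with structure morphism
`A ♭ X ⟶ B ♭ X ⟶ X`. -/
noncomputable def InternalAction.restrict {A B X : C} (f : A ⟶ B) (a : InternalAction B X) :
    InternalAction A X where
  ξ := flatMap f (𝟙 X) ≫ a.ξ
  unit := by rw [← Category.assoc, flatUnit_flatMap, a.unit]
  assoc := by
    rw [← Category.assoc, flatMult_flatMap, Category.assoc, a.assoc, ← Category.assoc,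
      ← Category.assoc, flatMap_comp, flatMap_comp]
    simp

/-- The functor `Act(-, X) : Cᵒᵖ ⥤ Type`. -/
noncomputable def actFunctor (X : C) : Cᵒᵖ ⥤ Type v where
  obj B := InternalAction B.unop X
  map f := ↾ (fun a => a.restrict f.unop)
  map_id B := by
    ext a
    change flatMap (𝟙 B.unop) (𝟙 X) ≫ a.ξ = a.ξ
    rw [flatMap_id, Category.id_comp]
  map_comp f g := by
    ext a
    change flatMap (g.unop ≫ f.unop) (𝟙 X) ≫ a.ξ
      = flatMap g.unop (𝟙 X) ≫ flatMap f.unop (𝟙 X) ≫ a.ξ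
    rw [← Category.assoc, flatMap_comp, Category.comp_id]

variable (C)

/-- Every object `X` has an actor: `Act(-, X)` is representable. -/
def ActionRepresentative : Prop := ∀ X : C, (actFunctor X).IsRepresentable

/-- Condition (UA). -/
def ConditionUA : Prop :=
  ∀ ⦃A B D : C⦄ (f : A ⟶ B) (g : D ⟶ B), JointlyStronglyEpi f g →
    ∀ (X : C) (ξ₁ : InternalAction A X) (ξ₂ : InternalAction D X) (ξ₃ ξ₄ : InternalAction B X),
      flatMap f (𝟙 X) ≫ ξ₃.ξ = ξ₁.ξ → flatMap f (𝟙 X) ≫ ξ₄.ξ = ξ₁.ξ →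
      flatMap g (𝟙 X) ≫ ξ₃.ξ = ξ₂.ξ → flatMap g (𝟙 X) ≫ ξ₄.ξ = ξ₂.ξ →
      ξ₃ = ξ₄

end InternalActions

/-! ### Categories of interest -/

/-- An additively written, not necessarily commutative, group with further unary operations
indexed by `Ω₁` and further binary operations indexed by `Ω₂`. -/
class GroupWithOps (Ω₁ Ω₂ : Type w) (A : Type w) extends AddGroup A where
  /-- the unary operations other than `-` -/
  un : Ω₁ → A → A
  /-- the binary operations other than `+` -/
  bin : Ω₂ → A → A → A

/-- Words in `0, -, +` and the operations of `Ω₁` and `Ω₂`, with variables in `V`. -/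
inductive OpWord (Ω₁ Ω₂ : Type w) (V : Type w) : Type w
  | var : V → OpWord Ω₁ Ω₂ V
  | zero : OpWord Ω₁ Ω₂ V
  | neg : OpWord Ω₁ Ω₂ V → OpWord Ω₁ Ω₂ V
  | plus : OpWord Ω₁ Ω₂ V → OpWord Ω₁ Ω₂ V → OpWord Ω₁ Ω₂ V
  | un : Ω₁ → OpWord Ω₁ Ω₂ V → OpWord Ω₁ Ω₂ V
  | bin : Ω₂ → OpWord Ω₁ Ω₂ V → OpWord Ω₁ Ω₂ V → OpWord Ω₁ Ω₂ V

/-- The value of a word at an assignment of elements to its variables. -/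
def OpWord.eval {Ω₁ Ω₂ V A : Type w} [GroupWithOps Ω₁ Ω₂ A] (x : V → A) : OpWord Ω₁ Ω₂ V → A
  | .var i => x i
  | .zero => 0
  | .neg s => -(s.eval x)
  | .plus s t => s.eval x + t.eval x
  | .un o s => GroupWithOps.un (Ω₂ := Ω₂) o (s.eval x)
  | .bin m s t => GroupWithOps.bin (Ω₁ := Ω₁) m (s.eval x) (t.eval x)

/-- The data presenting a variety of groups with operations: the operations other than `0, -, +`
(all unary or binary), and a set of identities in countably many variables, imposed in addition
to the group laws. -/
structure OpTheory where
  /-- unary operations other than `-` -/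
  Ω₁ : Type w
  /-- binary operations other than `+` -/
  Ω₂ : Type w
  /-- identities -/
  E : Set (OpWord Ω₁ Ω₂ (ULift.{w} ℕ) × OpWord Ω₁ Ω₂ (ULift.{w} ℕ))

namespace OpTheory

/-- The objects of the variety: groups with operations satisfying all the identities. -/
structure Model (T : OpTheory.{w}) where
  /-- the underlying set -/
  carrier : Type w
  [str : GroupWithOps T.Ω₁ T.Ω₂ carrier]
  sat : ∀ e ∈ T.E, ∀ x : ULift.{w} ℕ → carrier, e.1.eval x = e.2.eval x

variable {T : OpTheory.{w}}

instance : CoeSort T.Model (Type w) := ⟨Model.carrier⟩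

instance (A : T.Model) : GroupWithOps T.Ω₁ T.Ω₂ A := A.str

namespace Model

/-- The value of a unary operation. -/
def un (A : T.Model) (o : T.Ω₁) (x : A) : A := GroupWithOps.un (Ω₂ := T.Ω₂) o x

/-- The value of a binary operation. -/
def bin (A : T.Model) (m : T.Ω₂) (x y : A) : A := GroupWithOps.bin (Ω₁ := T.Ω₁) m x y

/-- Homomorphisms: maps preserving all the operations. -/
@[ext]
structure Hom (A B : T.Model) extends A →+ B where
  map_un' : ∀ (o : T.Ω₁) (x : A), toFun (A.un o x) = B.un o (toFun x)
  map_bin' : ∀ (m : T.Ω₂) (x y : A), toFun (A.bin m x y) = B.bin m (toFun x) (toFun y)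

instance : Category T.Model where
  Hom := Hom
  id A := { AddMonoidHom.id A with
    map_un' := fun _ _ => rfl
    map_bin' := fun _ _ _ => rfl }
  comp f g := { g.toAddMonoidHom.comp f.toAddMonoidHom with
    map_un' := fun o x => (congrArg g.toFun (f.map_un' o x)).trans (g.map_un' o _)
    map_bin' := fun m x y => (congrArg g.toFun (f.map_bin' m x y)).trans (g.map_bin' m _ _) }

/-- The additive map underlying a morphism. -/
def map {A B : T.Model} (f : A ⟶ B) : A →+ B := Hom.toAddMonoidHom f

theorem map_un {A B : T.Model} (f : A ⟶ B) (o : T.Ω₁) (x : A) :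
    map f (A.un o x) = B.un o (map f x) := Hom.map_un' f o x

theorem map_bin {A B : T.Model} (f : A ⟶ B) (m : T.Ω₂) (x y : A) :
    map f (A.bin m x y) = B.bin m (map f x) (map f y) := Hom.map_bin' f m x y

theorem map_comp {A B D : T.Model} (f : A ⟶ B) (g : B ⟶ D) (x : A) :
    map (f ≫ g) x = map g (map f x) := rfl

theorem hom_ext {A B : T.Model} {f g : A ⟶ B} (h : ∀ x, map f x = map g x) : f = g :=
  Hom.ext (funext h)

/-- Constructor for morphisms. -/
def mkHom {A B : T.Model} (f : A →+ B) (h₁ : ∀ o x, f (A.un o x) = B.un o (f x))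
    (h₂ : ∀ m x y, f (A.bin m x y) = B.bin m (f x) (f y)) : A ⟶ B :=
  ({ f with map_un' := h₁, map_bin' := h₂ } : Hom A B)

theorem map_eval {V : Type w} {A B : T.Model} (f : A ⟶ B) (x : V → A)
    (s : OpWord T.Ω₁ T.Ω₂ V) : map f (s.eval x) = s.eval (fun i => map f (x i)) := by
  induction s with
  | var i => rfl
  | zero => exact map_zero _
  | neg s ih => simp only [OpWord.eval, _root_.map_neg, ih]
  | plus s t ih₁ ih₂ => simp only [OpWord.eval, _root_.map_add, ih₁, ih₂]
  | un o s ih => exact (map_un f o _).trans (congrArg (B.un o) ih)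
  | bin m s t ih₁ ih₂ => exact (map_bin f m _ _).trans (congrArg₂ (B.bin m) ih₁ ih₂)

/-! Binary coproducts: words in the elements of `A` and `B`, two words being identified when they
take the same value for all pairs of homomorphisms out of `A` and `B`. -/

section Coproduct

variable (A B : T.Model)

/-- The value of a word in the elements of `A` and `B` under two homomorphisms. -/
def coprodEval {Z : T.Model} (f : A ⟶ Z) (g : B ⟶ Z)
    (s : OpWord T.Ω₁ T.Ω₂ (A.carrier ⊕ B.carrier)) : Z := s.eval (Sum.elim (map f) (map g))

/-- The relation identifying two words with the same values. -/
def coprodSetoid : Setoid (OpWord T.Ω₁ T.Ω₂ (A.carrier ⊕ B.carrier)) where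
  r s t := ∀ (Z : T.Model) (f : A ⟶ Z) (g : B ⟶ Z), coprodEval A B f g s = coprodEval A B f g t
  iseqv := ⟨fun _ _ _ _ => rfl, fun h Z f g => (h Z f g).symm,
    fun h₁ h₂ Z f g => (h₁ Z f g).trans (h₂ Z f g)⟩

/-- The underlying set of the coproduct. -/
abbrev CoprodCarrier : Type w := Quotient (coprodSetoid A B)

variable {A B}

/-- The map out of the coproduct induced by two homomorphisms. -/
def coprodDescFun {Z : T.Model} (f : A ⟶ Z) (g : B ⟶ Z) : CoprodCarrier A B → Z :=
  Quotient.lift (coprodEval A B f g) (fun _ _ h => h Z f g)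

theorem coprodCarrier_ext {x y : CoprodCarrier A B}
    (h : ∀ (Z : T.Model) (f : A ⟶ Z) (g : B ⟶ Z), coprodDescFun f g x = coprodDescFun f g y) :
    x = y := by
  induction x using Quotient.inductionOn
  induction y using Quotient.inductionOn
  exact Quotient.sound h

instance : Zero (CoprodCarrier A B) := ⟨Quotient.mk _ .zero⟩

instance : Neg (CoprodCarrier A B) := ⟨Quotient.map .neg
  (fun _ _ h Z f g => congrArg (fun z => -z) (h Z f g))⟩

instance : Add (CoprodCarrier A B) := ⟨Quotient.map₂ .plus
  (fun _ _ h _ _ h' Z f g => congrArg₂ (fun z z' => z + z') (h Z f g) (h' Z f g))⟩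

theorem coprodDescFun_zero {Z : T.Model} (f : A ⟶ Z) (g : B ⟶ Z) :
    coprodDescFun f g 0 = 0 := rfl

theorem coprodDescFun_neg {Z : T.Model} (f : A ⟶ Z) (g : B ⟶ Z) (x : CoprodCarrier A B) :
    coprodDescFun f g (-x) = -coprodDescFun f g x := by
  induction x using Quotient.inductionOn; rfl

theorem coprodDescFun_add {Z : T.Model} (f : A ⟶ Z) (g : B ⟶ Z) (x y : CoprodCarrier A B) :
    coprodDescFun f g (x + y) = coprodDescFun f g x + coprodDescFun f g y := by
  induction x using Quotient.inductionOn
  induction y using Quotient.inductionOn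
  rfl

instance : AddGroup (CoprodCarrier A B) :=
  AddGroup.ofLeftAxioms
    (fun x y z => coprodCarrier_ext fun Z f g => by simp only [coprodDescFun_add, add_assoc])
    (fun x => coprodCarrier_ext fun Z f g => by
      simp only [coprodDescFun_add, coprodDescFun_zero, zero_add])
    (fun x => coprodCarrier_ext fun Z f g => by
      simp only [coprodDescFun_add, coprodDescFun_neg, coprodDescFun_zero, neg_add_cancel])

instance : GroupWithOps T.Ω₁ T.Ω₂ (CoprodCarrier A B) where
  un o := Quotient.map (.un o) (fun _ _ h Z f g => congrArg (Z.un o) (h Z f g))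
  bin m := Quotient.map₂ (.bin m)
    (fun _ _ h _ _ h' Z f g => congrArg₂ (Z.bin m) (h Z f g) (h' Z f g))

theorem coprodDescFun_un {Z : T.Model} (f : A ⟶ Z) (g : B ⟶ Z) (o : T.Ω₁)
    (x : CoprodCarrier A B) :
    coprodDescFun f g (GroupWithOps.un (Ω₂ := T.Ω₂) o x) = Z.un o (coprodDescFun f g x) := by
  induction x using Quotient.inductionOn; rfl

theorem coprodDescFun_bin {Z : T.Model} (f : A ⟶ Z) (g : B ⟶ Z) (m : T.Ω₂)
    (x y : CoprodCarrier A B) :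
    coprodDescFun f g (GroupWithOps.bin (Ω₁ := T.Ω₁) m x y)
      = Z.bin m (coprodDescFun f g x) (coprodDescFun f g y) := by
  induction x using Quotient.inductionOn
  induction y using Quotient.inductionOn
  rfl

theorem coprodDescFun_eval {V : Type w} {Z : T.Model} (f : A ⟶ Z) (g : B ⟶ Z)
    (x : V → CoprodCarrier A B) (s : OpWord T.Ω₁ T.Ω₂ V) :
    coprodDescFun f g (s.eval x) = s.eval (fun i => coprodDescFun f g (x i)) := by
  induction s with
  | var i => rfl
  | zero => rfl
  | neg s ih => simp only [OpWord.eval, coprodDescFun_neg, ih]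
  | plus s t ih₁ ih₂ => simp only [OpWord.eval, coprodDescFun_add, ih₁, ih₂]
  | un o s ih => exact (coprodDescFun_un f g o _).trans (congrArg (Z.un o) ih)
  | bin m s t ih₁ ih₂ =>
    exact (coprodDescFun_bin f g m _ _).trans (congrArg₂ (Z.bin m) ih₁ ih₂)

variable (A B)

/-- The coproduct of two objects. -/
def coprodModel : T.Model where
  carrier := CoprodCarrier A B
  sat e he x := coprodCarrier_ext fun Z f g => by
    rw [coprodDescFun_eval, coprodDescFun_eval, Z.sat e he]

/-- The first injection. -/
def coprodInl : A ⟶ coprodModel A B :=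
  mkHom (B := coprodModel A B)
    (AddMonoidHom.mk' (fun a => (Quotient.mk _ (.var (.inl a)) : CoprodCarrier A B))
      (fun a a' => coprodCarrier_ext fun _ f _ => _root_.map_add (map f) a a'))
    (fun o a => coprodCarrier_ext fun _ f _ => map_un f o a)
    (fun m a a' => coprodCarrier_ext fun _ f _ => map_bin f m a a')

/-- The second injection. -/
def coprodInr : B ⟶ coprodModel A B :=
  mkHom (B := coprodModel A B)
    (AddMonoidHom.mk' (fun a => (Quotient.mk _ (.var (.inr a)) : CoprodCarrier A B))
      (fun a a' => coprodCarrier_ext fun _ _ g => _root_.map_add (map g) a a'))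
    (fun o a => coprodCarrier_ext fun _ _ g => map_un g o a)
    (fun m a a' => coprodCarrier_ext fun _ _ g => map_bin g m a a')

variable {A B}

/-- The morphism out of the coproduct induced by two homomorphisms. -/
def coprodDesc {Z : T.Model} (f : A ⟶ Z) (g : B ⟶ Z) : coprodModel A B ⟶ Z :=
  mkHom (A := coprodModel A B) (AddMonoidHom.mk' (coprodDescFun f g) (coprodDescFun_add f g))
    (coprodDescFun_un f g) (coprodDescFun_bin f g)

theorem coprod_hom_ext {Z : T.Model} {h h' : coprodModel A B ⟶ Z}
    (h₁ : coprodInl A B ≫ h = coprodInl A B ≫ h')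
    (h₂ : coprodInr A B ≫ h = coprodInr A B ≫ h') : h = h' := by
  apply hom_ext
  intro x
  induction x using Quotient.inductionOn with
  | h s =>
    induction s with
    | var i =>
      cases i with
      | inl a => exact congrArg (fun k => map k a) h₁
      | inr b => exact congrArg (fun k => map k b) h₂
    | zero => exact (_root_.map_zero (map h)).trans (_root_.map_zero (map h')).symm
    | neg s ih =>
      exact (_root_.map_neg (map h) _).trans
        ((congrArg (fun z => -z) ih).trans (_root_.map_neg (map h') _).symm)
    | plus s t ih₁ ih₂ =>
      exact (_root_.map_add (map h) _ _).trans
        ((congrArg₂ (fun z z' => z + z') ih₁ ih₂).trans (_root_.map_add (map h') _ _).symm)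
    | un o s ih =>
      exact (map_un h o _).trans ((congrArg (Z.un o) ih).trans (map_un h' o _).symm)
    | bin m s t ih₁ ih₂ =>
      exact (map_bin h m _ _).trans
        ((congrArg₂ (Z.bin m) ih₁ ih₂).trans (map_bin h' m _ _).symm)

instance : HasBinaryCoproducts T.Model :=
  have : ∀ A B : T.Model, HasColimit (pair A B) := fun A B =>
    ⟨⟨⟨BinaryCofan.mk (coprodInl A B) (coprodInr A B),
      BinaryCofan.isColimitMk (fun s => coprodDesc s.inl s.inr)
        (fun _ => rfl) (fun _ => rfl)
        (fun _ _ h₁ h₂ => coprod_hom_ext h₁ h₂)⟩⟩⟩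
  hasBinaryCoproducts_of_hasColimit_pair _

end Coproduct

end Model

/-- Three-fold products of `x₁, x₂, x₃` in which `x₁` and `x₂` are not multiplied with each
other first; the juxtapositions stand for operations `m, n` of `Ω₂`, the outer one for `m`. -/
def tripleProduct (A : T.Model) (x₁ x₂ x₃ : A) :
    ULift.{w} (Fin 8) × T.Ω₂ × T.Ω₂ → A
  | (⟨0⟩, m, n) => A.bin m x₁ (A.bin n x₂ x₃)
  | (⟨1⟩, m, n) => A.bin m x₁ (A.bin n x₃ x₂)
  | (⟨2⟩, m, n) => A.bin m (A.bin n x₂ x₃) x₁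
  | (⟨3⟩, m, n) => A.bin m (A.bin n x₃ x₂) x₁
  | (⟨4⟩, m, n) => A.bin m x₂ (A.bin n x₁ x₃)
  | (⟨5⟩, m, n) => A.bin m x₂ (A.bin n x₃ x₁)
  | (⟨6⟩, m, n) => A.bin m (A.bin n x₁ x₃) x₂
  | (⟨7⟩, m, n) => A.bin m (A.bin n x₃ x₁) x₂

/-- Orzech's conditions: the category of models is a category of interest. An identity belongs
to the theory when it holds in all models. -/
class IsOfInterest (T : OpTheory.{w}) : Prop where
  /-- with `*`, also the opposite operation belongs to `Ω₂` -/
  exists_opposite : ∀ m : T.Ω₂, ∃ m' : T.Ω₂, ∀ (A : T.Model) (x y : A), A.bin m' x y = A.bin m y x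
  /-- `x * (y + z) = x * y + x * z` -/
  bin_add : ∀ (m : T.Ω₂) (A : T.Model) (x y z : A),
    A.bin m x (y + z) = A.bin m x y + A.bin m x z
  /-- `ω (x + y) = ω x + ω y` -/
  un_add : ∀ (o : T.Ω₁) (A : T.Model) (x y : A), A.un o (x + y) = A.un o x + A.un o y
  /-- `ω x * y = ω (x * y)` -/
  un_bin : ∀ (o : T.Ω₁) (m : T.Ω₂) (A : T.Model) (x y : A),
    A.bin m (A.un o x) y = A.un o (A.bin m x y)
  /-- `x + y * z = y * z + x` -/
  add_bin_comm : ∀ (m : T.Ω₂) (A : T.Model) (x y z : A),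
    x + A.bin m y z = A.bin m y z + x
  /-- for all `*, *'` there is a word `W` such that `(x₁ * x₂) *' x₃ = W(x₁(x₂x₃), x₁(x₃x₂),
  (x₂x₃)x₁, (x₃x₂)x₁, x₂(x₁x₃), x₂(x₃x₁), (x₁x₃)x₂, (x₃x₁)x₂)`, where the juxtapositions stand
  for operations of `Ω₂` -/
  exists_word : ∀ m m' : T.Ω₂, ∃ W : OpWord T.Ω₁ T.Ω₂ (ULift.{w} (Fin 8) × T.Ω₂ × T.Ω₂),
    ∀ (A : T.Model) (x₁ x₂ x₃ : A),
      A.bin m' (A.bin m x₁ x₂) x₃ = W.eval (tripleProduct A x₁ x₂ x₃)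

namespace Model

variable [T.IsOfInterest]

theorem un_zero (A : T.Model) (o : T.Ω₁) : A.un o 0 = 0 := by
  have h := IsOfInterest.un_add o A 0 0
  rw [add_zero] at h
  exact left_eq_add.mp h

theorem bin_zero (A : T.Model) (m : T.Ω₂) (x : A) : A.bin m x 0 = 0 := by
  have h := IsOfInterest.bin_add m A x 0 0
  rw [add_zero] at h
  exact left_eq_add.mp h

instance : HasZeroMorphisms T.Model where
  zero _ B := ⟨mkHom 0 (fun o _ => (un_zero B o).symm) (fun m _ _ => (bin_zero B m 0).symm)⟩
  comp_zero _ _ := rfl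
  zero_comp _ _ _ f := hom_ext fun _ => _root_.map_zero (map f)

theorem map_zero_hom {A B : T.Model} (x : A) : map (0 : A ⟶ B) x = 0 := rfl

/-- The underlying set of the kernel of a morphism. -/
abbrev KerCarrier {A B : T.Model} (f : A ⟶ B) : Type w := (map f).ker

instance {A B : T.Model} (f : A ⟶ B) : GroupWithOps T.Ω₁ T.Ω₂ (KerCarrier f) where
  un o x := ⟨A.un o x.1, by
    rw [AddMonoidHom.mem_ker, map_un, AddMonoidHom.mem_ker.mp x.2, un_zero]⟩
  bin m x y := ⟨A.bin m x.1 y.1, by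
    rw [AddMonoidHom.mem_ker, map_bin, AddMonoidHom.mem_ker.mp x.2, AddMonoidHom.mem_ker.mp y.2,
      bin_zero]⟩

theorem ker_eval {V : Type w} {A B : T.Model} (f : A ⟶ B) (x : V → KerCarrier f)
    (s : OpWord T.Ω₁ T.Ω₂ V) : (s.eval x).1 = s.eval (fun i => (x i).1) := by
  induction s with
  | var i => rfl
  | zero => rfl
  | neg s ih => exact congrArg (fun z => -z) ih
  | plus s t ih₁ ih₂ => exact congrArg₂ (fun z z' => z + z') ih₁ ih₂
  | un o s ih => exact congrArg (A.un o) ih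
  | bin m s t ih₁ ih₂ => exact congrArg₂ (A.bin m) ih₁ ih₂

/-- The kernel of a morphism. -/
def kerModel {A B : T.Model} (f : A ⟶ B) : T.Model where
  carrier := KerCarrier f
  sat e he x := Subtype.ext (by rw [ker_eval, ker_eval, A.sat e he])

/-- The inclusion of the kernel. -/
def kerι {A B : T.Model} (f : A ⟶ B) : kerModel f ⟶ A :=
  mkHom (A := kerModel f) (map f).ker.subtype (fun _ _ => rfl) (fun _ _ _ => rfl)

theorem kerι_comp {A B : T.Model} (f : A ⟶ B) : kerι f ≫ f = 0 :=
  hom_ext fun x => AddMonoidHom.mem_ker.mp (Subtype.property (p := fun y => y ∈ (map f).ker) x)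

/-- The universal property of the kernel. -/
def kerLift {A B Z : T.Model} (f : A ⟶ B) (h : Z ⟶ A) (w : h ≫ f = 0) : Z ⟶ kerModel f :=
  mkHom (B := kerModel f)
    ((map h).codRestrict (map f).ker (fun z => congrArg (fun k => map k z) w))
    (fun o z => Subtype.ext (map_un h o z)) (fun m z z' => Subtype.ext (map_bin h m z z'))

instance : HasKernels T.Model where
  has_limit f := ⟨⟨⟨KernelFork.ofι (kerι f) (kerι_comp f),
    KernelFork.IsLimit.ofι _ _ (fun h w => kerLift f h w) (fun _ _ => rfl)
      (fun _ _ _ hk => hom_ext fun z => Subtype.ext (congrArg (fun l => map l z) hk))⟩⟩⟩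

end Model

end OpTheory

/-!
Both parts reduce (UA) to the principle that a subobject through which both legs of a jointly
strongly epimorphic cospan factor is everything.

For action representative categories, two actions of `B` on `X` are two morphisms from `B` to the
representing object. If they agree after composition with both legs of the cospan, the legs factor
through their equalizer, so that the two morphisms are equal
(`JointlyStronglyEpi.hom_ext`).

For categories of interest, an action `ξ` of `B` on `X` is determined by the elements
`ξ (b + x - b)` and `ξ (b * x)`. To compare two actions `ξ₃`, `ξ₄`, let `E` be the subalgebra of
`B + X` of those elements of `B ♭ X` on which they agree (`agreement`). The algebra law for `ξ₃` and
`ξ₄` shows that if `E` contains `b + x - b` for all `x` in `X`, it is stable under conjugation by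
`b`, and similarly for `b * -` (`conj_mem_agreement`, `bin_mem_agreement`). If this holds for all
`b`, then the elements `k + b` with `k` in `E` form a subalgebra of `B + X` containing `B` and `X`,
so it is everything and `ξ₃ = ξ₄` (`InternalAction.eq_of_agreement`).

The `b` for which all `b * x` lie in `E` form a subalgebra of `B` (`multiplierAgreement`): closure
under products is what the words `W` provide, since they express `(b * b') * x` through iterated
products such as `b * (b' * x)`. The `b` for which all `b + x - b` lie in `E` form only a subgroup
(`conjAgreement`), as nothing controls conjugation by `ω b`; but this subgroup contains all products,
because these are central. The subgroup of `B` generated by the images of the two legs and by all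
products is a subalgebra, hence equal to `B`, and so `conjAgreement` is `B` too.
-/

/-! ### Jointly strongly epimorphic cospans and representable actions -/

section Representable

variable {C : Type u} [Category.{v} C]

/-- Jointly strongly epimorphic cospans are jointly epimorphic, by lifting the identity along an
equalizer. -/
theorem JointlyStronglyEpi.hom_ext [HasEqualizers C] {A B D Z : C} {f : A ⟶ B} {g : D ⟶ B}
    (hfg : JointlyStronglyEpi f g) {p q : B ⟶ Z} (hf : f ≫ p = f ≫ q) (hg : g ≫ p = g ≫ q) :
    p = q := by
  obtain ⟨t, -, -, ht⟩ := hfg (equalizer.ι p q) (equalizer.lift f hf) (equalizer.lift g hg) (𝟙 B)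
    (by simp) (by simp)
  rw [← Category.id_comp p, ← Category.id_comp q, ← ht, Category.assoc, Category.assoc,
    equalizer.condition]

theorem ActionRepresentative.conditionUA [HasZeroMorphisms C] [HasBinaryCoproducts C]
    [HasKernels C] [HasEqualizers C] (hC : ActionRepresentative C) : ConditionUA C := by
  intro A B D f g hfg X ξ₁ ξ₂ ξ₃ ξ₄ h₃f h₄f h₃g h₄g
  have := hC X
  have r := (actFunctor X).representableBy
  have key : ∀ {Z : C} (p : Z ⟶ B), flatMap p (𝟙 X) ≫ ξ₃.ξ = flatMap p (𝟙 X) ≫ ξ₄.ξ →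
      p ≫ r.homEquiv.symm ξ₃ = p ≫ r.homEquiv.symm ξ₄ := fun {Z} p hp =>
    (r.comp_homEquiv_symm ξ₃ p).trans
      ((congrArg r.homEquiv.symm
        (InternalAction.ext hp : ξ₃.restrict p = ξ₄.restrict p)).trans
        (r.comp_homEquiv_symm ξ₄ p).symm)
  exact r.homEquiv.symm.injective
    (hfg.hom_ext (key f (h₃f.trans h₄f.symm)) (key g (h₃g.trans h₄g.symm)))

end Representable

namespace OpTheory

namespace Model

variable {T : OpTheory.{w}}

/-! ### Subalgebras and coproducts -/

/-- A subgroup of a model that is closed under the further unary and binary operations. -/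
structure IsSubalgebra (A : T.Model) (S : AddSubgroup A) : Prop where
  un_mem : ∀ (o : T.Ω₁) {x : A}, x ∈ S → A.un o x ∈ S
  bin_mem : ∀ (m : T.Ω₂) {x y : A}, x ∈ S → y ∈ S → A.bin m x y ∈ S

/-- A subalgebra as a model in its own right. -/
@[reducible] def IsSubalgebra.groupWithOps {A : T.Model} {S : AddSubgroup A}
    (hS : IsSubalgebra A S) : GroupWithOps T.Ω₁ T.Ω₂ S where
  un o x := ⟨A.un o x.1, hS.un_mem o x.2⟩
  bin m x y := ⟨A.bin m x.1 y.1, hS.bin_mem m x.2 y.2⟩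

theorem IsSubalgebra.coe_eval {V : Type w} {A : T.Model} {S : AddSubgroup A}
    (hS : IsSubalgebra A S) (x : V → S) (s : OpWord T.Ω₁ T.Ω₂ V) :
    letI := hS.groupWithOps
    (s.eval x).1 = s.eval (fun i => (x i).1) := by
  let := hS.groupWithOps
  induction s with
  | var i => rfl
  | zero => rfl
  | neg s ih => exact congrArg (fun z => -z) ih
  | plus s t ih₁ ih₂ => exact congrArg₂ (fun z z' => z + z') ih₁ ih₂
  | un o s ih => exact congrArg (A.un o) ih
  | bin m s t ih₁ ih₂ => exact congrArg₂ (A.bin m) ih₁ ih₂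

theorem IsSubalgebra.eval_mem {V : Type w} {A : T.Model} {S : AddSubgroup A}
    (hS : IsSubalgebra A S) {x : V → A} (hx : ∀ i, x i ∈ S) (s : OpWord T.Ω₁ T.Ω₂ V) :
    s.eval x ∈ S := by
  let := hS.groupWithOps
  exact hS.coe_eval (fun i => ⟨x i, hx i⟩) s ▸ (s.eval fun i => (⟨x i, hx i⟩ : S)).2

/-- A subalgebra as an object of the variety. -/
def IsSubalgebra.model {A : T.Model} {S : AddSubgroup A} (hS : IsSubalgebra A S) : T.Model :=
  letI := hS.groupWithOps
  { carrier := S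
    sat := fun e he x => Subtype.ext (by rw [hS.coe_eval, hS.coe_eval, A.sat e he]) }

/-- The inclusion of a subalgebra. -/
def IsSubalgebra.incl {A : T.Model} {S : AddSubgroup A} (hS : IsSubalgebra A S) :
    hS.model ⟶ A :=
  mkHom (A := hS.model) S.subtype (fun _ _ => rfl) (fun _ _ _ => rfl)

theorem IsSubalgebra.incl_mem {A : T.Model} {S : AddSubgroup A} (hS : IsSubalgebra A S)
    (x : hS.model) : map hS.incl x ∈ S :=
  Subtype.property (p := fun y => y ∈ S) x

instance {A : T.Model} {S : AddSubgroup A} (hS : IsSubalgebra A S) : Mono hS.incl where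
  right_cancellation _ _ h := hom_ext fun z => Subtype.ext (congrArg (fun l => map l z) h)

/-- A morphism with values in a subalgebra, as a morphism into it. -/
def IsSubalgebra.lift {A Z : T.Model} {S : AddSubgroup A} (hS : IsSubalgebra A S) (f : Z ⟶ A)
    (hf : ∀ z, map f z ∈ S) : Z ⟶ hS.model :=
  mkHom (B := hS.model) ((map f).codRestrict S hf)
    (fun o z => Subtype.ext (map_un f o z)) (fun m z z' => Subtype.ext (map_bin f m z z'))

theorem IsSubalgebra.mem_of_jointlyStronglyEpi {A B D : T.Model} {f : A ⟶ B} {g : D ⟶ B}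
    (hfg : JointlyStronglyEpi f g) {S : AddSubgroup B} (hS : IsSubalgebra B S)
    (hf : ∀ a, map f a ∈ S) (hg : ∀ d, map g d ∈ S) (b : B) : b ∈ S := by
  obtain ⟨t, -, -, ht⟩ := hfg hS.incl (hS.lift f hf) (hS.lift g hg) (𝟙 B) rfl rfl
  have h : map hS.incl (map t b) = b := congrArg (fun l => map l b) ht
  exact h ▸ hS.incl_mem _

theorem jointlyStronglyEpi_coprod (A B : T.Model) :
    JointlyStronglyEpi (coprod.inl : A ⟶ A ⨿ B) (coprod.inr : B ⟶ A ⨿ B) := by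
  intro M N m _ a d h ha hd
  refine ⟨coprod.desc a d, coprod.inl_desc _ _, coprod.inr_desc _ _, ?_⟩
  ext
  · rw [coprod.inl_desc_assoc, ha]
  · rw [coprod.inr_desc_assoc, hd]

theorem map_inl_desc {A B Z : T.Model} (f : A ⟶ Z) (g : B ⟶ Z) (a : A) :
    map (coprod.desc f g) (map coprod.inl a) = map f a :=
  congrArg (fun l => map l a) (coprod.inl_desc f g)

theorem map_inr_desc {A B Z : T.Model} (f : A ⟶ Z) (g : B ⟶ Z) (b : B) :
    map (coprod.desc f g) (map coprod.inr b) = map g b :=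
  congrArg (fun l => map l b) (coprod.inr_desc f g)

theorem map_inl_map {A B A' B' : T.Model} (f : A ⟶ A') (g : B ⟶ B') (a : A) :
    map (coprod.map f g) (map coprod.inl a) = map coprod.inl (map f a) :=
  congrArg (fun l => map l a) (coprod.inl_map f g)

theorem map_inr_map {A B A' B' : T.Model} (f : A ⟶ A') (g : B ⟶ B') (b : B) :
    map (coprod.map f g) (map coprod.inr b) = map coprod.inr (map g b) :=
  congrArg (fun l => map l b) (coprod.inr_map f g)

theorem map_id (A : T.Model) (a : A) : map (𝟙 A) a = a := rfl

variable [T.IsOfInterest]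

/-! ### Arithmetic in a category of interest -/

theorem add_bin (A : T.Model) (m : T.Ω₂) (x y z : A) :
    A.bin m (x + y) z = A.bin m x z + A.bin m y z := by
  obtain ⟨m', hm'⟩ := IsOfInterest.exists_opposite m
  rw [← hm', ← hm', ← hm', IsOfInterest.bin_add]

theorem zero_bin (A : T.Model) (m : T.Ω₂) (x : A) : A.bin m 0 x = 0 := by
  have h := add_bin A m 0 0 x
  rw [add_zero] at h
  exact left_eq_add.mp h

theorem neg_bin (A : T.Model) (m : T.Ω₂) (x y : A) : A.bin m (-x) y = -A.bin m x y := by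
  apply eq_neg_of_add_eq_zero_left
  rw [← add_bin, neg_add_cancel, zero_bin]

/-! ### Elements of `B ♭ X` -/

theorem map_flatι_injective (B X : T.Model) : Function.Injective (map (flatι B X)) := by
  intro k k' h
  let e : flat B X ⟶ kerModel (coprod.desc (𝟙 B) (0 : X ⟶ B)) :=
    kerLift _ (flatι B X) (flatι_comp B X)
  have he : e ≫ flatLift (kerι _) (kerι_comp _) = 𝟙 (flat B X) := by
    rw [← cancel_mono (flatι B X), Category.assoc, flatLift_ι, Category.id_comp]
    rfl
  have hk : map e k = map e k' := Subtype.ext h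
  have h₁ := congrArg (fun l => map l k) he
  have h₂ := congrArg (fun l => map l k') he
  exact h₁.symm.trans ((congrArg (map (flatLift (kerι _) (kerι_comp _))) hk).trans h₂)

theorem map_desc_flatι {B X : T.Model} (k : (flat B X : T.Model)) :
    map (coprod.desc (𝟙 B) (0 : X ⟶ B)) (map (flatι B X) k) = 0 :=
  congrArg (fun l => map l k) (flatι_comp B X)

theorem exists_flatι_eq {B X : T.Model} {y : (B ⨿ X : T.Model)}
    (hy : map (coprod.desc (𝟙 B) (0 : X ⟶ B)) y = 0) : ∃ k, map (flatι B X) k = y :=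
  ⟨map (flatLift (kerι _) (kerι_comp _)) (⟨y, hy⟩ : KerCarrier _),
    congrArg (fun l => map l (⟨y, hy⟩ : KerCarrier _)) (flatLift_ι (kerι _) (kerι_comp _))⟩

theorem map_flatι_flatMap {A B X Y : T.Model} (f : A ⟶ B) (h : X ⟶ Y) (k : (flat A X : T.Model)) :
    map (flatι B Y) (map (flatMap f h) k) = map (coprod.map f h) (map (flatι A X) k) :=
  congrArg (fun l => map l k) (flatLift_ι (flatι A X ≫ coprod.map f h) _)

theorem map_flatι_flatMult {B X : T.Model} (k : (flat B (flat B X) : T.Model)) :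
    map (flatι B X) (map (flatMult B X) k)
      = map (coprod.desc coprod.inl (flatι B X)) (map (flatι B (flat B X)) k) :=
  congrArg (fun l => map l k) (flatLift_ι (flatι B (flat B X) ≫ _) _)

theorem map_flatι_flatUnit {B X : T.Model} (x : X) :
    map (flatι B X) (map (flatUnit B X) x) = map coprod.inr x :=
  congrArg (fun l => map l x) (flatLift_ι coprod.inr _)

theorem map_ξ_of_flatι_eq_inr {B X : T.Model} (a : InternalAction B X)
    {k : (flat B X : T.Model)} {x : X}
    (hk : map (flatι B X) k = map coprod.inr x) : map a.ξ k = x := by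
  rw [← map_flatι_flatUnit] at hk
  rw [map_flatι_injective B X hk]
  exact congrArg (fun l => map l x) a.unit

/-- The associativity law of an action, for elements: an element `y` of `B + B ♭ X` lying in
`B ♭ (B ♭ X)` gives two elements of `B ♭ X`, by evaluating it in `B + X` and by letting its
components in `B ♭ X` act first; these have the same image in `X`. -/
theorem map_ξ_eq {B X : T.Model} (a : InternalAction B X) {y : (B ⨿ flat B X : T.Model)}
    (hy : map (coprod.desc (𝟙 B) (0 : flat B X ⟶ B)) y = 0) {k₁ k₂ : (flat B X : T.Model)}
    (h₁ : map (flatι B X) k₁ = map (coprod.desc coprod.inl (flatι B X)) y)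
    (h₂ : map (flatι B X) k₂ = map (coprod.map (𝟙 B) a.ξ) y) : map a.ξ k₁ = map a.ξ k₂ := by
  obtain ⟨z, rfl⟩ := exists_flatι_eq hy
  rw [← map_flatι_flatMult] at h₁
  rw [← map_flatι_flatMap] at h₂
  rw [map_flatι_injective B X h₁, map_flatι_injective B X h₂]
  exact congrArg (fun l => map l z) a.assoc

/-! ### The elements on which two actions agree -/

section Agreement

variable {B X : T.Model} (a a' : InternalAction B X)

/-- The elements of `B ♭ X`, regarded as a subgroup of `B + X`, on which two actions agree. -/
noncomputable def agreement : AddSubgroup (B ⨿ X : T.Model) :=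
  ((map a.ξ).eqLocus (map a'.ξ)).map (map (flatι B X))

variable {a a'}

theorem mem_agreement {y : (B ⨿ X : T.Model)} : y ∈ agreement a a' ↔
    ∃ k, map a.ξ k = map a'.ξ k ∧ map (flatι B X) k = y := Iff.rfl

theorem map_ξ_eq_of_mem_agreement {k : (flat B X : T.Model)}
    (hk : map (flatι B X) k ∈ agreement a a') :
    map a.ξ k = map a'.ξ k := by
  obtain ⟨k', h, h'⟩ := hk
  rwa [← map_flatι_injective B X h']

theorem isSubalgebra_agreement : IsSubalgebra (B ⨿ X) (agreement a a') where
  un_mem o x hx := by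
    obtain ⟨k, hk, rfl⟩ := mem_agreement.mp hx
    exact mem_agreement.mpr ⟨(flat B X).un o k, by rw [map_un, map_un, hk], map_un _ _ _⟩
  bin_mem m x y hx hy := by
    obtain ⟨k, hk, rfl⟩ := mem_agreement.mp hx
    obtain ⟨l, hl, rfl⟩ := mem_agreement.mp hy
    exact mem_agreement.mpr
      ⟨(flat B X).bin m k l, by rw [map_bin, map_bin, hk, hl], map_bin _ _ _ _⟩

theorem inr_mem_agreement (x : X) : map coprod.inr x ∈ agreement a a' := by
  have h := map_flatι_flatUnit (B := B) x
  exact mem_agreement.mpr ⟨map (flatUnit B X) x,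
    (map_ξ_of_flatι_eq_inr a h).trans (map_ξ_of_flatι_eq_inr a' h).symm, h⟩

/-- Two actions agree on an element evaluated from `B + B ♭ X` when they agree after acting on the
components in `B ♭ X`. -/
theorem desc_mem_agreement {y : (B ⨿ flat B X : T.Model)}
    (hy : map (coprod.desc (𝟙 B) (0 : flat B X ⟶ B)) y = 0)
    (h : map (coprod.map (𝟙 B) a.ξ) y = map (coprod.map (𝟙 B) a'.ξ) y)
    (hmem : map (coprod.map (𝟙 B) a.ξ) y ∈ agreement a a') :
    map (coprod.desc coprod.inl (flatι B X)) y ∈ agreement a a' := by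
  obtain ⟨k, hk, hky⟩ := mem_agreement.mp hmem
  obtain ⟨z, rfl⟩ := exists_flatι_eq hy
  exact mem_agreement.mpr ⟨map (flatMult B X) z,
    (map_ξ_eq a hy (map_flatι_flatMult z) hky).trans
      (hk.trans (map_ξ_eq a' hy (map_flatι_flatMult z) (hky.trans h)).symm),
    map_flatι_flatMult z⟩

theorem conj_mem_agreement {b : B}
    (hb : ∀ x : X, map coprod.inl b + map coprod.inr x - map coprod.inl b ∈ agreement a a')
    {y : (B ⨿ X : T.Model)} (hy : y ∈ agreement a a') :
    map coprod.inl b + y - map coprod.inl b ∈ agreement a a' := by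
  obtain ⟨k, hk, rfl⟩ := mem_agreement.mp hy
  have h := desc_mem_agreement (a := a) (a' := a')
    (y := map coprod.inl b + map coprod.inr k - map coprod.inl b)
  simp only [_root_.map_sub, _root_.map_add, map_inl_desc, map_inr_desc, map_inl_map, map_inr_map,
    map_id, map_zero_hom, add_zero, sub_self, hk, true_implies] at h
  exact h (hb _)

theorem bin_mem_agreement {b : B} {m : T.Ω₂}
    (hb : ∀ x : X, (B ⨿ X).bin m (map coprod.inl b) (map coprod.inr x) ∈ agreement a a')
    {y : (B ⨿ X : T.Model)} (hy : y ∈ agreement a a') :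
    (B ⨿ X).bin m (map coprod.inl b) y ∈ agreement a a' := by
  obtain ⟨k, hk, rfl⟩ := mem_agreement.mp hy
  have h := desc_mem_agreement (a := a) (a' := a')
    (y := (B ⨿ flat B X).bin m (map coprod.inl b) (map coprod.inr k))
  simp only [map_bin, map_inl_desc, map_inr_desc, map_inl_map, map_inr_map,
    map_id, map_zero_hom, bin_zero, hk, true_implies] at h
  exact h (hb _)

/-- An action is determined by the elements `ξ (b + x - b)` and `ξ (b * x)`. -/
theorem InternalAction.eq_of_agreement
    (hconj : ∀ (b : B) (x : X),
      map coprod.inl b + map coprod.inr x - map coprod.inl b ∈ agreement a a')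
    (hbin : ∀ (m : T.Ω₂) (b : B) (x : X),
      (B ⨿ X).bin m (map coprod.inl b) (map coprod.inr x) ∈ agreement a a') : a = a' := by
  let U : AddSubgroup (B ⨿ X : T.Model) :=
    { carrier := {y | ∃ k ∈ agreement a a', ∃ b : B, k + map coprod.inl b = y}
      zero_mem' := ⟨0, zero_mem _, 0, by rw [_root_.map_zero, add_zero]⟩
      add_mem' := by
        rintro _ _ ⟨k, hk, b, rfl⟩ ⟨k', hk', b', rfl⟩
        refine ⟨k + (map coprod.inl b + k' - map coprod.inl b),
          add_mem hk (conj_mem_agreement (hconj b) hk'), b + b', ?_⟩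
        rw [_root_.map_add]
        simp only [sub_eq_add_neg, add_assoc, neg_add_cancel_left]
      neg_mem' := by
        rintro _ ⟨k, hk, b, rfl⟩
        refine ⟨map coprod.inl (-b) + -k - map coprod.inl (-b),
          conj_mem_agreement (hconj _) (neg_mem hk), -b, ?_⟩
        rw [_root_.map_neg, neg_add_rev, sub_add_cancel] }
  have hU : IsSubalgebra (B ⨿ X) U :=
    { un_mem := by
        rintro o _ ⟨k, hk, b, rfl⟩
        refine ⟨_, isSubalgebra_agreement.un_mem o hk, B.un o b, ?_⟩
        rw [map_un]
        exact (IsOfInterest.un_add _ _ _ _).symm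
      bin_mem := by
        rintro m _ _ ⟨k, hk, b, rfl⟩ ⟨k', hk', b', rfl⟩
        obtain ⟨m', hm'⟩ := IsOfInterest.exists_opposite m
        refine ⟨(B ⨿ X).bin m k k' + (B ⨿ X).bin m (map coprod.inl b) k'
          + (B ⨿ X).bin m k (map coprod.inl b'), add_mem (add_mem
            (isSubalgebra_agreement.bin_mem m hk hk') (bin_mem_agreement (hbin m b) hk')) ?_,
          B.bin m b b', ?_⟩
        · rw [← hm']
          exact bin_mem_agreement (hbin m' b') hk
        · rw [IsOfInterest.bin_add, add_bin, add_bin, map_bin]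
          simp only [add_assoc] }
  have hall := hU.mem_of_jointlyStronglyEpi (jointlyStronglyEpi_coprod B X)
    (fun b => ⟨0, zero_mem _, b, zero_add _⟩)
    (fun x => ⟨_, inr_mem_agreement x, 0, by rw [_root_.map_zero, add_zero]⟩)
  ext1
  apply hom_ext
  intro z
  apply map_ξ_eq_of_mem_agreement
  obtain ⟨k, hk, b, hkb⟩ := hall (map (flatι B X) z)
  -- Projecting to `B` shows that the component in `B` of an element of `B ♭ X` vanishes.
  obtain ⟨l, -, hl⟩ := mem_agreement.mp hk
  have hb : b = 0 := by
    have h := congrArg (map (coprod.desc (𝟙 B) (0 : X ⟶ B))) hkb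
    rwa [_root_.map_add, ← hl, map_desc_flatι, map_desc_flatι, zero_add, map_inl_desc] at h
  rw [hb, _root_.map_zero, add_zero] at hkb
  exact hkb ▸ hk

/-- If the restrictions along `f` of two actions are equal, then the actions agree on the image of
`A ♭ X`. -/
theorem map_mem_agreement {A : T.Model} {f : A ⟶ B}
    (hf : flatMap f (𝟙 X) ≫ a.ξ = flatMap f (𝟙 X) ≫ a'.ξ) {y : (A ⨿ X : T.Model)}
    (hy : map (coprod.desc (𝟙 A) (0 : X ⟶ A)) y = 0) :
    map (coprod.map f (𝟙 X)) y ∈ agreement a a' := by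
  obtain ⟨k, rfl⟩ := exists_flatι_eq hy
  exact mem_agreement.mpr
    ⟨map (flatMap f (𝟙 X)) k, congrArg (fun l => map l k) hf, map_flatι_flatMap _ _ _⟩

/-! ### The elements of `B` that act in the same way -/

variable (a a')

/-- The elements of `B` that act in the same way by conjugation under two actions. -/
noncomputable def conjAgreement : AddSubgroup B where
  carrier := {b | ∀ x : X,
    map coprod.inl b + map coprod.inr x - map coprod.inl b ∈ agreement a a'}
  zero_mem' x := by
    rw [_root_.map_zero, zero_add, sub_zero]
    exact inr_mem_agreement x
  add_mem' {b b'} hb hb' x := by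
    have h := conj_mem_agreement hb (hb' x)
    rw [_root_.map_add]
    simpa only [sub_eq_add_neg, neg_add_rev, add_assoc] using h
  neg_mem' {b} hb x := by
    have hker : map (coprod.desc (𝟙 B) (0 : X ⟶ B))
        (map coprod.inl (-b) + map coprod.inr x - map coprod.inl (-b)) = 0 := by
      simp only [_root_.map_sub, _root_.map_add, map_inl_desc, map_inr_desc, map_zero_hom,
        add_zero, sub_self]
    obtain ⟨k, hk⟩ := exists_flatι_eq hker
    -- With `x' = ξ (-b + x + b)`, conjugation by `b` sends `x'` back to `x` under the first action,
    -- hence also under the second, so that `-b` sends `x` to `x'` under the second action too.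
    obtain ⟨l, hl, hlx⟩ := mem_agreement.mp (hb (map a.ξ k))
    have h₁ : map a.ξ (map (flatUnit B X) x) = map a.ξ l := by
      apply map_ξ_eq a (y := map coprod.inl b + map coprod.inr k - map coprod.inl b)
      · simp only [_root_.map_sub, _root_.map_add, map_inl_desc, map_inr_desc, map_zero_hom,
          add_zero, sub_self]
      · simp only [_root_.map_sub, _root_.map_add, map_inl_desc, map_inr_desc, hk,
          map_flatι_flatUnit, _root_.map_neg]
        simp [sub_eq_add_neg, add_assoc]
      · simp only [hlx, _root_.map_sub, _root_.map_add, map_inl_map, map_inr_map, map_id]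
    rw [map_ξ_of_flatι_eq_inr a (map_flatι_flatUnit x)] at h₁
    have h₂ : map a'.ξ (map (flatUnit B X) (map a.ξ k)) = map a'.ξ k := by
      apply map_ξ_eq a' (y := map coprod.inl (-b) + map coprod.inr l - map coprod.inl (-b))
      · simp only [_root_.map_sub, _root_.map_add, map_inl_desc, map_inr_desc, map_zero_hom,
          add_zero, sub_self]
      · simp only [_root_.map_sub, _root_.map_add, map_inl_desc, map_inr_desc, hlx,
          map_flatι_flatUnit, _root_.map_neg]
        simp [sub_eq_add_neg, add_assoc]
      · simp only [hk, _root_.map_sub, _root_.map_add, map_inl_map, map_inr_map, map_id, ← hl,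
          ← h₁]
    rw [map_ξ_of_flatι_eq_inr a' (map_flatι_flatUnit _)] at h₂
    exact mem_agreement.mpr ⟨k, h₂, hk⟩

/-- The elements of `B` that act in the same way through all the binary operations under two
actions. -/
noncomputable def multiplierAgreement : AddSubgroup B where
  carrier := {b | ∀ (m : T.Ω₂) (x : X),
    (B ⨿ X).bin m (map coprod.inl b) (map coprod.inr x) ∈ agreement a a'}
  zero_mem' m x := by
    rw [_root_.map_zero, zero_bin]
    exact zero_mem _
  add_mem' {b b'} hb hb' m x := by
    rw [_root_.map_add, add_bin]
    exact add_mem (hb m x) (hb' m x)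
  neg_mem' {b} hb m x := by
    rw [_root_.map_neg, neg_bin]
    exact neg_mem (hb m x)

theorem isSubalgebra_multiplierAgreement : IsSubalgebra B (multiplierAgreement a a') where
  un_mem o b hb m x := by
    rw [map_un, IsOfInterest.un_bin]
    exact isSubalgebra_agreement.un_mem o (hb m x)
  bin_mem m b b' hb hb' m' x := by
    obtain ⟨W, hW⟩ := IsOfInterest.exists_word m m'
    rw [map_bin, hW]
    apply isSubalgebra_agreement.eval_mem
    have left : ∀ {c : B}, c ∈ multiplierAgreement a a' → ∀ (n : T.Ω₂) {y : (B ⨿ X : T.Model)},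
        y ∈ agreement a a' → (B ⨿ X).bin n (map coprod.inl c) y ∈ agreement a a' :=
      fun hc n _ hy => bin_mem_agreement (hc n) hy
    have right : ∀ {c : B}, c ∈ multiplierAgreement a a' → ∀ (n : T.Ω₂) {y : (B ⨿ X : T.Model)},
        y ∈ agreement a a' → (B ⨿ X).bin n y (map coprod.inl c) ∈ agreement a a' := by
      intro c hc n y hy
      obtain ⟨n', hn'⟩ := IsOfInterest.exists_opposite n
      rw [← hn']
      exact left hc n' hy
    have hx := inr_mem_agreement (a := a) (a' := a') x
    rintro ⟨⟨i⟩, n, n'⟩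
    fin_cases i
    · exact left hb n (left hb' n' hx)
    · exact left hb n (right hb' n' hx)
    · exact right hb n (left hb' n' hx)
    · exact right hb n (right hb' n' hx)
    · exact left hb' n (left hb n' hx)
    · exact left hb' n (right hb n' hx)
    · exact right hb' n (left hb n' hx)
    · exact right hb' n (right hb n' hx)

/-- Products are central, so they act trivially by conjugation. -/
theorem bin_mem_conjAgreement (m : T.Ω₂) (b b' : B) : B.bin m b b' ∈ conjAgreement a a' := by
  intro x
  rw [map_bin, ← IsOfInterest.add_bin_comm, add_sub_cancel_right]
  exact inr_mem_agreement x

end Agreement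

/-- The subgroup generated by a set closed under the unary operations, together with all products,
is a subalgebra. -/
theorem isSubalgebra_closure (B : T.Model) {G : Set B} (hG : ∀ (o : T.Ω₁), ∀ b ∈ G, B.un o b ∈ G) :
    IsSubalgebra B (AddSubgroup.closure (G ∪ {b | ∃ m c c', B.bin m c c' = b})) where
  un_mem o b hb := by
    induction hb using AddSubgroup.closure_induction with
    | mem b hb =>
      apply AddSubgroup.subset_closure
      obtain hb | ⟨m, c, c', rfl⟩ := hb
      · exact Or.inl (hG o b hb)
      · exact Or.inr ⟨m, B.un o c, c', IsOfInterest.un_bin o m B c c'⟩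
    | zero => exact (un_zero B o).symm ▸ zero_mem _
    | add b b' _ _ h h' => exact (IsOfInterest.un_add o B b b').symm ▸ add_mem h h'
    | neg b _ h =>
      have hneg : B.un o (-b) = -B.un o b := by
        apply eq_neg_of_add_eq_zero_left
        rw [← IsOfInterest.un_add, neg_add_cancel, un_zero]
      exact hneg ▸ neg_mem h
  bin_mem m b b' _ _ := AddSubgroup.subset_closure (Or.inr ⟨m, b, b', rfl⟩)

theorem conditionUA (T : OpTheory.{w}) [T.IsOfInterest] : ConditionUA T.Model := by
  intro A B D f g hfg X ξ₁ ξ₂ ξ₃ ξ₄ h₃f h₄f h₃g h₄g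
  have hf := h₃f.trans h₄f.symm
  have hg := h₃g.trans h₄g.symm
  have conj_of : ∀ {Z : T.Model} {p : Z ⟶ B},
      flatMap p (𝟙 X) ≫ ξ₃.ξ = flatMap p (𝟙 X) ≫ ξ₄.ξ →
      ∀ z, map p z ∈ conjAgreement ξ₃ ξ₄ := by
    intro Z p hp z x
    have h := map_mem_agreement hp
      (y := map coprod.inl z + map coprod.inr x - map coprod.inl z)
      (by simp only [_root_.map_sub, _root_.map_add, map_inl_desc, map_inr_desc, map_zero_hom,
        add_zero, sub_self])
    rwa [_root_.map_sub, _root_.map_add, map_inl_map, map_inr_map] at h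
  have multiplier_of : ∀ {Z : T.Model} {p : Z ⟶ B},
      flatMap p (𝟙 X) ≫ ξ₃.ξ = flatMap p (𝟙 X) ≫ ξ₄.ξ →
      ∀ z, map p z ∈ multiplierAgreement ξ₃ ξ₄ := by
    intro Z p hp z m x
    have h := map_mem_agreement hp (y := (Z ⨿ X).bin m (map coprod.inl z) (map coprod.inr x))
      (by rw [map_bin, map_inr_desc, map_zero_hom, bin_zero])
    rwa [map_bin, map_inl_map, map_inr_map] at h
  apply InternalAction.eq_of_agreement
  · have hS := isSubalgebra_closure B (G := Set.range (map f) ∪ Set.range (map g)) (by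
      rintro o _ (⟨z, rfl⟩ | ⟨z, rfl⟩)
      · exact Or.inl ⟨A.un o z, map_un f o z⟩
      · exact Or.inr ⟨D.un o z, map_un g o z⟩)
    have hle : AddSubgroup.closure ((Set.range (map f) ∪ Set.range (map g)) ∪
        {b | ∃ m c c', B.bin m c c' = b}) ≤ conjAgreement ξ₃ ξ₄ := by
      rw [AddSubgroup.closure_le]
      rintro _ ((⟨z, rfl⟩ | ⟨z, rfl⟩) | ⟨m, c, c', rfl⟩)
      · exact conj_of hf z
      · exact conj_of hg z
      · exact bin_mem_conjAgreement ξ₃ ξ₄ m c c'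
    exact fun b => hle (hS.mem_of_jointlyStronglyEpi hfg
      (fun z => AddSubgroup.subset_closure (Or.inl (Or.inl ⟨z, rfl⟩)))
      (fun z => AddSubgroup.subset_closure (Or.inl (Or.inr ⟨z, rfl⟩))) b)
  · exact fun m b x => (isSubalgebra_multiplierAgreement ξ₃ ξ₄).mem_of_jointlyStronglyEpi hfg
      (multiplier_of hf) (multiplier_of hg) b m x

end Model

end OpTheory

theorem mainTheorem7 :
    (∀ (C : Type u) [Category.{v} C] [HasZeroMorphisms C] [SemiAbelian C],
      ActionRepresentative C → ConditionUA C) ∧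
    (∀ (T : OpTheory.{w}) [T.IsOfInterest], ConditionUA T.Model) :=
  ⟨fun _ _ _ _ hC => hC.conditionUA, fun T _ => OpTheory.Model.conditionUA T⟩
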